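/- Let $n\ge 2$ be an integer and let $D_{2n}=\langle a,b\mid a^n=b^2=(ab)^2=e\rangle$ be the dihedral group of order $2n$. Let $S$ be a generating set of $D_{2n}$ with $e\notin S=S^{-1}$, and let $\mathrm{Cay}(D_{2n},S)$ be the graph with vertex set $D_{2n}$ in which $u$ and $v$ are adjacent if and only if $uv^{-1}\in S$. The metric dimension $\dim_M(\Gamma)$ of a finite connected graph $\Gamma$ is the minimum cardinality of a resolving set, that is, of a set $W$ of vertices such that any two distinct vertices $x,y$ of $\Gamma$ satisfy $d(x,w)\neq d(y,w)$ for some $w\in W$, where $d$ is the graph distance. Then $\dim_M(\mathrm{Cay}(D_{2n},S))=2$ if and only if one of the following holds: (a) $n=|S|=2$; (b) $S=\{a^ib,a^jb\}$ for some integers $i,j$ with $\gcd(i-j,n)=1$; (c) $n$ is odd and $S=\{a^i,a^{-i},a^jb\}$ for some integers $i,j$ with $\gcd(i,n)=1$. -/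

import Mathlib

open scoped Pointwise

/-- The Cayley graph `Cay(G, S)`: distinct vertices `u`, `v` are adjacent when `u * v⁻¹ ∈ S`
(the relation is symmetrized; this changes nothing when `S = S⁻¹`). -/
def Cay {G : Type*} [Group G] (S : Set G) : SimpleGraph G :=
  SimpleGraph.fromRel fun u v => u * v⁻¹ ∈ S

theorem Cay_adj {G : Type*} [Group G] {S : Set G} (h1 : (1 : G) ∉ S) (hS : S = S⁻¹) (u v : G) :
    (Cay S).Adj u v ↔ u * v⁻¹ ∈ S := by
  have key : v * u⁻¹ ∈ S ↔ u * v⁻¹ ∈ S := by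
    conv_lhs => rw [hS]
    simp
  simp only [Cay, SimpleGraph.fromRel_adj, key, or_self, and_iff_right_iff_imp]
  rintro h rfl
  exact h1 (by simpa using h)

namespace SimpleGraph

/-- `W` is a resolving set of the (connected) graph `Γ`: vertices having the same distances to all
elements of `W` are equal. -/
def IsResolvingSet {V : Type*} (Γ : SimpleGraph V) (W : Set V) : Prop :=
  ∀ u v : V, (∀ w ∈ W, Γ.dist u w = Γ.dist v w) → u = v

/-- The metric dimension: the minimum cardinality of a resolving set. -/
noncomputable def metricDimension {V : Type*} (Γ : SimpleGraph V) : ℕ∞ :=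
  ⨅ (W : Set V) (_ : Γ.IsResolvingSet W), W.encard

end SimpleGraph

/-!
The graph `Cay S` is regular of valency `|S|`, and right translations are automorphisms.

Suppose `{w₁, w₂}` is resolving. The neighbours `s * w₁` of `w₁` all have distance `1` to `w₁`, so
their distances to `w₂` are pairwise different (`Cay_injOn_dist`); they also differ from
`d(w₁, w₂)` by at most one. Hence `|S| ≤ 3`, and when `|S| = 3` some neighbour of `w₁` is at
distance exactly `d(w₁, w₂)` from `w₂`, so the graph is not bipartite
(`Cay_encard_le_two_of_parity`). Now `S` generates, so it contains a reflection `sr p`.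

* If `sr p` is the only reflection, then `S = {r i, r (-i), sr p}` with `i` a unit of `ℤ/n`. When
  `i = -i` this forces `n = 2`; otherwise the graph is a prism over an `n`-cycle, bipartite for
  even `n`.
* If `S` consists of two reflections `sr p`, `sr (p + u)`, then `u` is a unit, and the graph is a
  `2n`-cycle.
* If `S` consists of three reflections, the graph is bipartite.
* If `S` consists of two reflections `sr p`, `sr (p + u)` and a rotation `r k`, then `k` is the
  involution of `ℤ/n`. For even `u` the graph is bipartite; for odd `u`, `u` is a unit and the graph
  is a Möbius ladder, in which two neighbours of a vertex always have the same distance to a given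
  vertex (`not_isResolvingSet_moebius`).

Conversely, explicit distance formulas show that two adjacent vertices resolve a `2n`-cycle and
that two vertices at distance `(n - 1) / 2` on one side resolve a prism over an odd `n`-cycle
(`metricDimension_cycle`, `metricDimension_prism`). A single vertex never suffices since it has two
neighbours at distance `1`.

Distances are computed by exhibiting a potential, see `SimpleGraph.dist_eq_of_potential`.
-/

/-! ### Cardinalities of small sets -/

theorem Set.encard_pair_le_two {α : Type*} (x y : α) : ({x, y} : Set α).encard ≤ 2 := by
  refine (Set.encard_insert_le _ _).trans ?_
  rw [Set.encard_singleton]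
  norm_num

theorem Set.eq_of_encard_le_three {α : Type*} {S : Set α} (h : S.encard ≤ 3) {x y z : α}
    (hx : x ∈ S) (hy : y ∈ S) (hz : z ∈ S) (hxy : x ≠ y) (hxz : x ≠ z) (hyz : y ≠ z) : S = {x, y, z} := by
  have hcard : ({x, y, z} : Set α).encard = 3 :=
    Set.encard_eq_three.mpr ⟨x, y, z, hxy, hxz, hyz, rfl⟩
  refine (Set.Finite.eq_of_subset_of_encard_le (Set.toFinite _) ?_ (h.trans hcard.ge)).symm
  rintro _ (rfl | rfl | rfl) <;> assumption

theorem Set.not_encard_triple_le_two {α : Type*} {x y z : α} (hxy : x ≠ y) (hxz : x ≠ z)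
    (hyz : y ≠ z) : ¬ ({x, y, z} : Set α).encard ≤ 2 := by
  rw [Set.encard_eq_three.mpr ⟨x, y, z, hxy, hxz, hyz, rfl⟩]
  norm_num

/-! ### Distances and resolving sets in graphs -/

namespace SimpleGraph

variable {V : Type*} {Γ : SimpleGraph V}

theorem IsResolvingSet.mono {W W' : Set V} (h : Γ.IsResolvingSet W) (hW : W ⊆ W') :
    Γ.IsResolvingSet W' :=
  fun u v huv => h u v fun w hw => huv w (hW hw)

/-- A function that vanishes only at `w`, is `1`-Lipschitz along edges and can be decreased by
moving to a neighbour is the distance to `w`. -/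
theorem dist_eq_of_potential (w : V) (f : V → ℕ) (h0 : f w = 0)
    (hlip : ∀ u v, Γ.Adj u v → f u ≤ f v + 1)
    (hdesc : ∀ v, v ≠ w → ∃ u, Γ.Adj v u ∧ f u < f v) (v : V) : Γ.dist v w = f v := by
  have upper : ∀ m v, f v ≤ m → ∃ p : Γ.Walk v w, p.length ≤ f v := by
    intro m
    induction m with
    | zero =>
      intro v hv
      by_cases hvw : v = w
      · subst hvw
        exact ⟨.nil, by simp⟩
      · obtain ⟨u, -, hu⟩ := hdesc v hvw
        omega
    | succ m ih =>
      intro v hv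
      by_cases hvw : v = w
      · subst hvw
        exact ⟨.nil, by simp⟩
      · obtain ⟨u, hadj, hu⟩ := hdesc v hvw
        obtain ⟨p, hp⟩ := ih u (by omega)
        exact ⟨.cons hadj p, by simp only [Walk.length_cons]; omega⟩
  have lower : ∀ u v (p : Γ.Walk u v), f u ≤ f v + p.length := by
    intro u v p
    induction p with
    | nil => simp
    | cons hadj p ih =>
      have := hlip _ _ hadj
      simp only [Walk.length_cons]
      omega
  obtain ⟨p, hp⟩ := upper _ v le_rfl
  obtain ⟨q, hq⟩ := Reachable.exists_walk_length_eq_dist ⟨p⟩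
  have h1 := dist_le p
  have h2 := lower _ _ q
  omega

/-- A potential `c` with values in `ℤ/2` that changes along every edge records the parity of the
distance. -/
theorem Connected.dist_cast_zmod_two (hΓ : Γ.Connected) (c : V → ZMod 2)
    (hc : ∀ u v, Γ.Adj u v → c u = c v + 1) (u v : V) : (Γ.dist u v : ZMod 2) = c u - c v := by
  obtain ⟨p, hp⟩ := hΓ.exists_walk_length_eq_dist u v
  rw [← hp]
  clear hp
  induction p with
  | nil => simp
  | cons hadj p ih =>
    rw [Walk.length_cons, Nat.cast_succ, ih, hc _ _ hadj]
    ring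

theorem exists_isResolvingSet_pair (h : Γ.metricDimension = 2) :
    ∃ w₁ w₂, Γ.IsResolvingSet {w₁, w₂} := by
  have hlt : Γ.metricDimension < 3 := by rw [h]; norm_num
  simp only [metricDimension, iInf_lt_iff] at hlt
  obtain ⟨W, hW, hcard⟩ := hlt
  have hle : W.encard ≤ 2 := by
    rw [show (3 : ℕ∞) = 2 + 1 by norm_num] at hcard
    exact Order.le_of_lt_add_one hcard
  by_cases hsub : W.encard ≤ 1
  · rcases Set.encard_le_one_iff_eq.mp hsub with rfl | ⟨w, rfl⟩
    · by_cases hV : Nonempty V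
      · obtain ⟨w⟩ := hV
        exact ⟨w, w, hW.mono (Set.empty_subset _)⟩
      · -- on the empty graph the dimension would be zero
        have : Γ.metricDimension ≤ 0 := by
          rw [← Set.encard_empty (α := V)]
          exact iInf₂_le _ hW
        rw [h] at this
        norm_num at this
    · exact ⟨w, w, hW.mono (by simp)⟩
  · have h2 : W.encard = 2 := le_antisymm hle (by
      rw [show (2 : ℕ∞) = 1 + 1 by norm_num]
      exact Order.add_one_le_of_lt (not_le.mp hsub))
    obtain ⟨x, y, -, rfl⟩ := Set.encard_eq_two.mp h2
    exact ⟨x, y, hW⟩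

/-- A graph in which every vertex has two different neighbours has no resolving set with at most
one element, so that a resolving pair is optimal. -/
theorem metricDimension_eq_two {w₁ w₂ : V} (h : Γ.IsResolvingSet {w₁, w₂})
    (hdeg : ∀ w, ∃ x y, x ≠ y ∧ Γ.Adj x w ∧ Γ.Adj y w) : Γ.metricDimension = 2 := by
  apply le_antisymm
  · exact (iInf₂_le _ h).trans (Set.encard_pair_le_two _ _)
  · refine le_iInf₂ fun W hW => ?_
    by_contra hlt
    have hle : W.encard ≤ 1 := by
      rw [not_le, show (2 : ℕ∞) = 1 + 1 by norm_num] at hlt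
      exact Order.le_of_lt_add_one hlt
    obtain ⟨w, hw⟩ : ∃ w, W ⊆ {w} := by
      rcases Set.encard_le_one_iff_eq.mp hle with rfl | ⟨w, rfl⟩
      · exact ⟨w₁, Set.empty_subset _⟩
      · exact ⟨w, le_rfl⟩
    obtain ⟨x, y, hxy, hx, hy⟩ := hdeg w
    refine hxy (hW.mono hw x y ?_)
    rintro _ rfl
    rw [dist_eq_one_iff_adj.mpr hx, dist_eq_one_iff_adj.mpr hy]

end SimpleGraph

/-! ### Cayley graphs -/

section Cayley

variable {G : Type*} [Group G] {S : Set G}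

theorem Cay_adj_mul_left (h1 : (1 : G) ∉ S) {s : G} (hs : s ∈ S) (g : G) :
    (Cay S).Adj (s * g) g := by
  simp only [Cay, SimpleGraph.fromRel_adj]
  refine ⟨?_, Or.inl (by simpa using hs)⟩
  intro h
  exact h1 (by simpa [mul_eq_right.mp h] using hs)

theorem Cay_connected (hgen : Subgroup.closure S = ⊤) (h1 : (1 : G) ∉ S) :
    (Cay S).Connected := by
  have key : ∀ x : G, ∀ g : G, (Cay S).Reachable (x * g) g := by
    intro x
    have hx : x ∈ Subgroup.closure S := hgen ▸ Subgroup.mem_top x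
    induction hx using Subgroup.closure_induction with
    | mem s hs => exact fun g => (Cay_adj_mul_left h1 hs g).reachable
    | one => exact fun g => by simp
    | mul x y _ _ hx hy =>
      intro g
      rw [mul_assoc]
      exact (hx _).trans (hy g)
    | inv x _ hx =>
      intro g
      have := (hx (x⁻¹ * g)).symm
      rwa [mul_inv_cancel_left] at this
  exact ⟨fun u v => by simpa using key (u * v⁻¹) v⟩

theorem Cay_dist_mul_right (hconn : (Cay S).Connected) (u v g : G) :
    (Cay S).dist (u * g) (v * g) = (Cay S).dist u v := by
  have key : ∀ u v g : G, (Cay S).dist (u * g) (v * g) ≤ (Cay S).dist u v := by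
    intro u v g
    let φ : Cay S →g Cay S := ⟨(· * g), fun {a b} h => by
      simpa [Cay, SimpleGraph.fromRel_adj] using h⟩
    obtain ⟨p, hp⟩ := hconn.exists_walk_length_eq_dist u v
    have := SimpleGraph.dist_le (p.map φ)
    rwa [SimpleGraph.Walk.length_map, hp] at this
  refine le_antisymm (key u v g) ?_
  simpa using key (u * g) (v * g) g⁻¹

/-- Distances in a Cayley graph from a potential: `dist_eq_of_potential` with the neighbours of `g`
written as `s * g` for `s ∈ S`. -/
theorem Cay_dist_eq_of_potential (h1 : (1 : G) ∉ S) (hinv : S = S⁻¹) (w : G) (f : G → ℕ)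
    (h0 : f w = 0) (hlip : ∀ s ∈ S, ∀ g, f (s * g) ≤ f g + 1)
    (hdesc : ∀ g, g ≠ w → ∃ s ∈ S, f (s * g) < f g) (g : G) : (Cay S).dist g w = f g := by
  refine SimpleGraph.dist_eq_of_potential w f h0 ?_ ?_ g
  · intro u v huv
    have := hlip _ ((Cay_adj h1 hinv u v).mp huv) v
    rwa [inv_mul_cancel_right] at this
  · intro v hv
    obtain ⟨s, hs, hlt⟩ := hdesc v hv
    exact ⟨s * v, (Cay_adj_mul_left h1 hs v).symm, hlt⟩

/-- If `{w₁, w₂}` is resolving, then the neighbours `s * w₁` of `w₁` have pairwise different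
distances to `w₂`, because they all have distance `1` to `w₁`. -/
theorem Cay_injOn_dist (h1 : (1 : G) ∉ S) {w₁ w₂ : G} (hW : (Cay S).IsResolvingSet {w₁, w₂}) :
    Set.InjOn (fun s => (Cay S).dist (s * w₁) w₂) S := by
  intro s hs t ht hst
  refine mul_right_cancel (hW (s * w₁) (t * w₁) ?_)
  rintro w (rfl | rfl)
  · rw [SimpleGraph.dist_eq_one_iff_adj.mpr (Cay_adj_mul_left h1 hs w),
      SimpleGraph.dist_eq_one_iff_adj.mpr (Cay_adj_mul_left h1 ht w)]
  · exact hst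

theorem Cay_mapsTo_dist (h1 : (1 : G) ∉ S) (w₁ w₂ : G) :
    Set.MapsTo (fun s => (Cay S).dist (s * w₁) w₂) S
      (Finset.Icc ((Cay S).dist w₁ w₂ - 1) ((Cay S).dist w₁ w₂ + 1)) := by
  intro s hs
  have := (Cay_adj_mul_left h1 hs w₁).diff_dist_adj (u := w₂)
  simp only [SimpleGraph.dist_comm (u := w₂)] at this
  simp only [Finset.coe_Icc, Set.mem_Icc]
  omega

theorem Cay_encard_le_three (h1 : (1 : G) ∉ S) {w₁ w₂ : G}
    (hW : (Cay S).IsResolvingSet {w₁, w₂}) : S.encard ≤ 3 := by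
  refine (Set.encard_le_encard_of_injOn (Cay_mapsTo_dist h1 w₁ w₂) (Cay_injOn_dist h1 hW)).trans ?_
  rw [Set.encard_coe_eq_coe_finsetCard, Nat.card_Icc]
  exact_mod_cast (by omega)

/-- A connected bipartite Cayley graph of valency at least three has no resolving pair: the
neighbours of `w₁` would have three different distances to `w₂`, one of which equals the distance
from `w₁` to `w₂`, against parity. -/
theorem Cay_encard_le_two_of_parity (hgen : Subgroup.closure S = ⊤) (h1 : (1 : G) ∉ S)
    (hinv : S = S⁻¹) {w₁ w₂ : G} (hW : (Cay S).IsResolvingSet {w₁, w₂}) (c : G → ZMod 2)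
    (hc : ∀ s ∈ S, ∀ g, c (s * g) = c g + 1) : S.encard ≤ 2 := by
  have hadj : ∀ u v, (Cay S).Adj u v → c u = c v + 1 := by
    intro u v huv
    have := hc _ ((Cay_adj h1 hinv u v).mp huv) v
    rwa [inv_mul_cancel_right] at this
  set d := (Cay S).dist w₁ w₂ with hd
  have hmaps : Set.MapsTo (fun s => (Cay S).dist (s * w₁) w₂) S
      ({d - 1, d + 1} : Set ℕ) := by
    intro s hs
    have hmem := Cay_mapsTo_dist h1 w₁ w₂ hs
    have hne : (Cay S).dist (s * w₁) w₂ ≠ d := by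
      intro heq
      have hconn := Cay_connected hgen h1
      have e1 := hconn.dist_cast_zmod_two c hadj (s * w₁) w₂
      rw [heq, hd, hconn.dist_cast_zmod_two c hadj w₁ w₂, hc s hs] at e1
      have : (1 : ZMod 2) = 0 := by linear_combination -e1
      exact one_ne_zero this
    simp only [Finset.coe_Icc, Set.mem_Icc] at hmem
    simp only [Set.mem_insert_iff, Set.mem_singleton_iff]
    omega
  exact (Set.encard_le_encard_of_injOn hmaps (Cay_injOn_dist h1 hW)).trans (Set.encard_pair_le_two _ _)

end Cayley

/-! ### Circular positions and residues -/

/-- The distance between the positions `x, y < N` on a cycle of length `N`. -/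
def cycDist (N x y : ℕ) : ℕ := min (max x y - min x y) (N - (max x y - min x y))

/-- `y` is the position after `x` on a cycle with the positions `0, …, N - 1`. -/
def IsNext (N x y : ℕ) : Prop := x + 1 = y ∨ (x + 1 = N ∧ y = 0)

theorem cycDist_self (N x : ℕ) : cycDist N x x = 0 := by
  simp [cycDist]

theorem IsNext.cycDist_le {N x y w : ℕ} (h : IsNext N x y) (hx : x < N) (hw : w < N) :
    cycDist N y w ≤ cycDist N x w + 1 ∧ cycDist N x w ≤ cycDist N y w + 1 := by
  unfold IsNext at h
  unfold cycDist
  omega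

theorem IsNext.cycDist_lt_or_lt {N x y z w : ℕ} (hxy : IsNext N x y) (hzx : IsNext N z x)
    (hx : x < N) (hw : w < N) (hne : x ≠ w) :
    cycDist N y w < cycDist N x w ∨ cycDist N z w < cycDist N x w := by
  unfold IsNext at hxy hzx
  unfold cycDist
  rcases lt_or_gt_of_ne hne with h | h
  · rw [max_eq_right h.le, min_eq_left h.le]
    omega
  · rw [max_eq_left h.le, min_eq_right h.le]
    omega

theorem cycDist_zero_right {N x : ℕ} : cycDist N x 0 = min x (N - x) := by
  simp [cycDist]

/-- On a cycle of length `2n`, one of the two neighbours of a position is farther from the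
position `0`, unless that position is the one opposite to `0`. -/
theorem IsNext.cycDist_zero_neighbours {n x y z : ℕ} (hn : 2 ≤ n) (hxy : IsNext (2 * n) x y)
    (hzx : IsNext (2 * n) z x) (hx : x < 2 * n) :
    (cycDist (2 * n) x 0 = n ∧ cycDist (2 * n) y 0 = cycDist (2 * n) z 0) ∨
      cycDist (2 * n) y 0 = cycDist (2 * n) x 0 + 1 ∨
      cycDist (2 * n) z 0 = cycDist (2 * n) x 0 + 1 := by
  unfold IsNext at hxy hzx
  simp only [cycDist_zero_right]
  omega

theorem cycDist_opposite {n x y : ℕ} (h : y = x + n ∨ y + n = x) (hx : x < 2 * n)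
    (hy : y < 2 * n) : cycDist (2 * n) y 0 + cycDist (2 * n) x 0 = n := by
  simp only [cycDist_zero_right]
  omega

theorem ZMod.isNext_val_add_one {n : ℕ} (hn : 2 ≤ n) (x : ZMod n) :
    IsNext n x.val (x + 1).val := by
  have : NeZero n := ⟨by omega⟩
  have : Fact (1 < n) := ⟨by omega⟩
  have hx := ZMod.val_lt x
  rw [ZMod.val_add, ZMod.val_one]
  by_cases h : x.val + 1 = n
  · exact Or.inr ⟨h, by rw [h, Nat.mod_self]⟩
  · exact Or.inl (Nat.mod_eq_of_lt (by omega)).symm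

theorem ZMod.isNext_val_sub_one {n : ℕ} (hn : 2 ≤ n) (x : ZMod n) :
    IsNext n (x - 1).val x.val := by
  simpa using ZMod.isNext_val_add_one hn (x - 1)

theorem ZMod.two_mul_val_of_involution {n : ℕ} (hn : 2 ≤ n) {k : ZMod n} (hk : k + k = 0)
    (hk0 : k ≠ 0) : 2 * k.val = n := by
  have : NeZero n := ⟨by omega⟩
  have hlt := ZMod.val_lt k
  have hpos : 0 < k.val := Nat.pos_of_ne_zero ((ZMod.val_ne_zero k).mpr hk0)
  have h := congrArg ZMod.val hk
  rw [ZMod.val_add, ZMod.val_zero] at h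
  obtain ⟨c, hc⟩ := Nat.dvd_of_mod_eq_zero h
  have hc1 : c = 1 := by
    have h1 : c < 2 := by nlinarith
    have h2 : 0 < c := by
      rcases Nat.eq_zero_or_pos c with rfl | h
      · omega
      · exact h
    omega
  subst hc1
  omega

theorem ZMod.two_eq_one_of_mul {x y : ZMod 2} (h : x * y = 1) : y = 1 := by
  revert x y
  decide

theorem ZMod.intGcd_eq_one_iff_isUnit {n : ℕ} (i : ℤ) : Int.gcd i n = 1 ↔ IsUnit (i : ZMod n) := by
  rw [ZMod.coe_int_isUnit_iff_isCoprime, isCoprime_comm, Int.isCoprime_iff_gcd_eq_one]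

/-! ### Cycle and Möbius ladder coordinates -/

namespace DihedralGroup

variable {n : ℕ}

/-- The position of a group element on the `2n`-cycle `Cay {sr p, sr (p + u)}` traversed from `1`
towards `sr p`, where `v` is the inverse of `u`: rotations occupy the even positions and
reflections the odd ones. -/
def cyclePos (p v : ZMod n) : DihedralGroup n → ℕ
  | r k => 2 * (-k * v).val
  | sr k => 2 * ((p - k) * v).val + 1

variable {p u v : ZMod n}

theorem one_ne_sr (k : ZMod n) : (1 : DihedralGroup n) ≠ sr k := by
  rw [one_def]
  exact nofun

theorem one_eq_r_iff {k : ZMod n} : (1 : DihedralGroup n) = r k ↔ k = 0 := by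
  rw [one_def, r.injEq, eq_comm]

theorem cyclePos_lt (hn : 2 ≤ n) (g : DihedralGroup n) : cyclePos p v g < 2 * n := by
  have : NeZero n := ⟨by omega⟩
  rcases g with k | k
  · have := ZMod.val_lt (-k * v)
    simp only [cyclePos]
    omega
  · have := ZMod.val_lt ((p - k) * v)
    simp only [cyclePos]
    omega

theorem cyclePos_injective (hn : 2 ≤ n) (hv : v * u = 1) :
    Function.Injective (cyclePos p v) := by
  have : NeZero n := ⟨by omega⟩
  intro g g' h
  rcases g with k | k <;> rcases g' with l | l <;> simp only [cyclePos] at h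
  · have h' : -k * v = -l * v := ZMod.val_injective n (by omega)
    congr 1
    linear_combination (-u) * h' + (l - k) * hv
  · omega
  · omega
  · have h' : (p - k) * v = (p - l) * v := ZMod.val_injective n (by omega)
    congr 1
    linear_combination (-u) * h' + (l - k) * hv

theorem cyclePos_one : cyclePos p v 1 = 0 := by
  rw [one_def]
  simp [cyclePos]

theorem cyclePos_sr : cyclePos p v (sr p) = 1 := by
  simp [cyclePos]

/-- The two generators `sr p` and `sr (p + u)` move every element to the next and to the previous
position, in an order depending on the element. -/
theorem cyclePos_isNext (hn : 2 ≤ n) (hv : v * u = 1) (g : DihedralGroup n) :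
    (IsNext (2 * n) (cyclePos p v g) (cyclePos p v (sr p * g)) ∧
      IsNext (2 * n) (cyclePos p v (sr (p + u) * g)) (cyclePos p v g)) ∨
    (IsNext (2 * n) (cyclePos p v g) (cyclePos p v (sr (p + u) * g)) ∧
      IsNext (2 * n) (cyclePos p v (sr p * g)) (cyclePos p v g)) := by
  rcases g with k | k
  · left
    have h := ZMod.isNext_val_sub_one hn (-k * v)
    have e1 : (p - (p + k)) * v = -k * v := by ring
    have e2 : (p - (p + u + k)) * v = -k * v - 1 := by linear_combination -hv
    simp only [sr_mul_r, cyclePos, e1, e2]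
    unfold IsNext at h ⊢
    omega
  · right
    have h := ZMod.isNext_val_add_one hn ((p - k) * v)
    have e1 : -(k - p) * v = (p - k) * v := by ring
    have e2 : -(k - (p + u)) * v = (p - k) * v + 1 := by linear_combination hv
    simp only [sr_mul_sr, cyclePos, e1, e2]
    unfold IsNext at h ⊢
    omega

/-- The central involution `r k` moves every element to the opposite position. -/
theorem cyclePos_involution (hn : 2 ≤ n) (hv : v * u = 1) {k : ZMod n} (hk : k + k = 0)
    (hk0 : k ≠ 0) (g : DihedralGroup n) :
    cyclePos p v (r k * g) = cyclePos p v g + n ∨ cyclePos p v (r k * g) + n = cyclePos p v g := by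
  have : NeZero n := ⟨by omega⟩
  have hκ : 2 * (k * v).val = n := by
    refine ZMod.two_mul_val_of_involution hn (by linear_combination v * hk) fun h => hk0 ?_
    linear_combination u * h - k * hv
  have add_val : ∀ x : ZMod n, 2 * (x + k * v).val = 2 * x.val + n ∨
      2 * (x + k * v).val + n = 2 * x.val := by
    intro x
    have hx := ZMod.val_lt x
    rw [ZMod.val_add]
    by_cases h : x.val + (k * v).val < n
    · rw [Nat.mod_eq_of_lt h]
      omega
    · rw [Nat.mod_eq_sub_mod (by omega), Nat.mod_eq_of_lt (by omega)]
      omega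
  rcases g with l | l
  · have e : -(k + l) * v = -l * v + k * v := by linear_combination (-v) * hk
    have h := add_val (-l * v)
    simp only [r_mul_r, cyclePos, e]
    omega
  · have e : (p - (l - k)) * v = (p - l) * v + k * v := by ring
    have h := add_val ((p - l) * v)
    simp only [r_mul_sr, cyclePos, e]
    omega

theorem Cay_cycle_dist (hn : 2 ≤ n) (hv : v * u = 1) (w g : DihedralGroup n) :
    (Cay {sr p, sr (p + u)}).dist g w = cycDist (2 * n) (cyclePos p v g) (cyclePos p v w) := by
  have hw := cyclePos_lt (p := p) (v := v) hn w
  refine Cay_dist_eq_of_potential (by simp [one_ne_sr]) (by simp) w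
    (fun g => cycDist (2 * n) (cyclePos p v g) (cyclePos p v w)) (cycDist_self _ _) ?_ ?_ g
  · intro s hs g
    rcases cyclePos_isNext (p := p) hn hv g with ⟨h1, h2⟩ | ⟨h1, h2⟩ <;>
      have l1 := h1.cycDist_le (cyclePos_lt hn _) hw <;>
      have l2 := h2.cycDist_le (cyclePos_lt hn _) hw <;>
      rcases hs with rfl | rfl <;> first | exact l1.1 | exact l2.2
  · intro g hgw
    have hne : cyclePos p v g ≠ cyclePos p v w :=
      fun h => hgw (cyclePos_injective hn hv h)
    rcases cyclePos_isNext (p := p) hn hv g with ⟨h1, h2⟩ | ⟨h1, h2⟩ <;>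
      rcases h1.cycDist_lt_or_lt h2 (cyclePos_lt hn _) hw hne with h | h <;>
      exact ⟨_, by simp, h⟩

theorem metricDimension_cycle (hn : 2 ≤ n) (hv : v * u = 1) :
    (Cay {sr p, sr (p + u)}).metricDimension = 2 := by
  have : Fact (1 < n) := ⟨by omega⟩
  have hu : u ≠ 0 := by
    rintro rfl
    simp at hv
  refine SimpleGraph.metricDimension_eq_two (w₁ := 1) (w₂ := sr p) ?_ ?_
  · intro x y hxy
    have h1 := hxy 1 (by simp)
    have h2 := hxy (sr p) (by simp)
    have hx := cyclePos_lt (p := p) (v := v) hn x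
    have hy := cyclePos_lt (p := p) (v := v) hn y
    rw [Cay_cycle_dist hn hv, Cay_cycle_dist hn hv] at h1 h2
    rw [cyclePos_one] at h1
    rw [cyclePos_sr] at h2
    apply cyclePos_injective (p := p) hn hv
    simp only [cycDist] at h1 h2
    omega
  · intro w
    refine ⟨sr p * w, sr (p + u) * w, ?_, Cay_adj_mul_left (by simp [one_ne_sr]) (by simp) w,
      Cay_adj_mul_left (by simp [one_ne_sr]) (by simp) w⟩
    intro h
    simpa [hu] using mul_right_cancel h

/-- The distance to `1` in the Möbius ladder, a `2n`-cycle with all chords joining opposite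
positions: one walks along the cycle, or takes a chord first. -/
theorem Cay_moebius_dist (hn : 2 ≤ n) (hv : v * u = 1) {k : ZMod n} (hk : k + k = 0)
    (hk0 : k ≠ 0) (g : DihedralGroup n) :
    (Cay {sr p, sr (p + u), r k}).dist g 1 =
      min (cycDist (2 * n) (cyclePos p v g) 0) (n + 1 - cycDist (2 * n) (cyclePos p v g) 0) := by
  have hkk : -k = k := by linear_combination -hk
  refine Cay_dist_eq_of_potential (by simp [one_ne_sr, one_eq_r_iff, hk0])
    (by simp [Set.inv_insert, hkk]) 1 (fun g =>
      min (cycDist (2 * n) (cyclePos p v g) 0) (n + 1 - cycDist (2 * n) (cyclePos p v g) 0))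
    (by simp [cycDist, cyclePos_one]) ?_ ?_ g
  · intro s hs g
    have hz := cycDist_opposite (cyclePos_involution (p := p) hn hv hk hk0 g) (cyclePos_lt hn _)
      (cyclePos_lt hn _)
    rcases cyclePos_isNext (p := p) hn hv g with ⟨h1, h2⟩ | ⟨h1, h2⟩ <;>
      have l1 := h1.cycDist_le (w := 0) (cyclePos_lt hn _) (by omega) <;>
      have l2 := h2.cycDist_le (w := 0) (cyclePos_lt hn _) (by omega) <;>
      rcases hs with rfl | rfl | rfl <;> omega
  · intro g hgw
    have hz := cycDist_opposite (cyclePos_involution (p := p) hn hv hk hk0 g) (cyclePos_lt hn _)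
      (cyclePos_lt hn _)
    have hne : cyclePos p v g ≠ 0 := by
      rw [← cyclePos_one (p := p) (v := v)]
      exact fun h => hgw (cyclePos_injective hn hv h)
    -- on the far half of the cycle the chord is the first step of a shortest walk
    by_cases hfar : n + 1 - cycDist (2 * n) (cyclePos p v g) 0 < cycDist (2 * n) (cyclePos p v g) 0
    · exact ⟨r k, by simp, by omega⟩
    · rcases cyclePos_isNext (p := p) hn hv g with ⟨h1, h2⟩ | ⟨h1, h2⟩ <;>
        rcases h1.cycDist_lt_or_lt h2 (cyclePos_lt hn _) (by omega) hne with h | h <;>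
        refine ⟨_, ?_, lt_of_le_of_lt (min_le_left _ _)
          (lt_of_lt_of_le h (le_min le_rfl (not_lt.mp hfar)))⟩ <;> simp

/-- The Möbius ladder has no resolving pair: for `g` not opposite to `1`, stepping along
the chord at `g` and stepping along the cycle away from `1` lead to the same distance from `1`; for
`g` opposite to `1` both steps along the cycle do. So two neighbours of `w₁` always have the same
distance to `w₂`. -/
theorem not_isResolvingSet_moebius (hn : 2 ≤ n) (hv : v * u = 1) {k : ZMod n} (hk : k + k = 0)
    (hk0 : k ≠ 0) (hgen : Subgroup.closure ({sr p, sr (p + u), r k} : Set (DihedralGroup n)) = ⊤)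
    (w₁ w₂ : DihedralGroup n) :
    ¬ (Cay {sr p, sr (p + u), r k}).IsResolvingSet {w₁, w₂} := by
  intro hW
  have : Fact (1 < n) := ⟨by omega⟩
  have hu : u ≠ 0 := by
    rintro rfl
    simp at hv
  have h1 : (1 : DihedralGroup n) ∉ ({sr p, sr (p + u), r k} : Set (DihedralGroup n)) := by
    simp [one_ne_sr, one_eq_r_iff, hk0]
  have hinj := Cay_injOn_dist h1 hW
  have hconn := Cay_connected hgen h1
  set g := w₁ * w₂⁻¹ with hg
  have hdist : ∀ s, (Cay {sr p, sr (p + u), r k}).dist (s * w₁) w₂ =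
      min (cycDist (2 * n) (cyclePos p v (s * g)) 0)
        (n + 1 - cycDist (2 * n) (cyclePos p v (s * g)) 0) := by
    intro s
    rw [← Cay_dist_mul_right hconn _ _ w₂⁻¹, mul_inv_cancel, mul_assoc,
      Cay_moebius_dist hn hv hk hk0]
  have n1 := hinj.ne (x := sr p) (y := sr (p + u)) (by simp) (by simp) (by simpa using hu)
  have n2 := hinj.ne (x := sr p) (y := r k) (by simp) (by simp) (by simp)
  have n3 := hinj.ne (x := sr (p + u)) (y := r k) (by simp) (by simp) (by simp)
  simp only [hdist] at n1 n2 n3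
  have hz := cycDist_opposite (cyclePos_involution (p := p) hn hv hk hk0 g) (cyclePos_lt hn _)
    (cyclePos_lt hn _)
  rcases cyclePos_isNext (p := p) hn hv g with ⟨h1, h2⟩ | ⟨h1, h2⟩ <;>
    rcases h1.cycDist_zero_neighbours hn h2 (cyclePos_lt hn _) with h | h | h <;>
    omega

/-! ### Prism coordinates -/

/-- The position of a group element on its `n`-cycle of the prism `Cay {r u, r (-u), sr p}`, where
`v` is the inverse of `u`: rotations form one cycle and reflections the other. -/
def prismPos (p v : ZMod n) : DihedralGroup n → ℕ
  | r k => (k * v).val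
  | sr k => ((k - p) * v).val

/-- The cycle of the prism on which a group element lies: `0` for rotations, `1` for
reflections. -/
def prismSide : DihedralGroup n → ℕ
  | r _ => 0
  | sr _ => 1

theorem prismPos_lt (hn : 2 ≤ n) (g : DihedralGroup n) : prismPos p v g < n := by
  have : NeZero n := ⟨by omega⟩
  rcases g with k | k <;> exact ZMod.val_lt _

theorem prism_ext (hn : 2 ≤ n) (hv : v * u = 1) {g g' : DihedralGroup n}
    (hpos : prismPos p v g = prismPos p v g') (hside : prismSide g = prismSide g') : g = g' := by
  have : NeZero n := ⟨by omega⟩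
  rcases g with k | k <;> rcases g' with l | l <;> simp only [prismPos, prismSide] at hpos hside
  · have h' := ZMod.val_injective n hpos
    congr 1
    linear_combination u * h' - (k - l) * hv
  · omega
  · omega
  · have h' := ZMod.val_injective n hpos
    congr 1
    linear_combination u * h' - (k - l) * hv

theorem prismSide_r_mul (k : ZMod n) (g : DihedralGroup n) : prismSide (r k * g) = prismSide g := by
  rcases g with l | l <;> rfl

theorem prismSide_sr_mul (k : ZMod n) (g : DihedralGroup n) :
    prismSide (sr k * g) = 1 - prismSide g := by
  rcases g with l | l <;> rfl

theorem prismSide_le_one (g : DihedralGroup n) : prismSide g ≤ 1 := by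
  rcases g with l | l <;> simp [prismSide]

theorem prismPos_sr_mul (g : DihedralGroup n) : prismPos p v (sr p * g) = prismPos p v g := by
  rcases g with l | l <;> simp [prismPos]

theorem prismPos_isNext (hn : 2 ≤ n) (hv : v * u = 1) (g : DihedralGroup n) :
    (IsNext n (prismPos p v g) (prismPos p v (r u * g)) ∧
      IsNext n (prismPos p v (r (-u) * g)) (prismPos p v g)) ∨
    (IsNext n (prismPos p v g) (prismPos p v (r (-u) * g)) ∧
      IsNext n (prismPos p v (r u * g)) (prismPos p v g)) := by
  rcases g with k | k
  · left
    have e1 : (u + k) * v = k * v + 1 := by linear_combination hv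
    have e2 : (-u + k) * v = k * v - 1 := by linear_combination -hv
    simp only [r_mul_r, prismPos, e1, e2]
    exact ⟨ZMod.isNext_val_add_one hn _, ZMod.isNext_val_sub_one hn _⟩
  · right
    have e1 : (k - u - p) * v = (k - p) * v - 1 := by linear_combination -hv
    have e2 : (k - -u - p) * v = (k - p) * v + 1 := by linear_combination hv
    simp only [r_mul_sr, prismPos, e1, e2]
    exact ⟨ZMod.isNext_val_add_one hn _, ZMod.isNext_val_sub_one hn _⟩

theorem Cay_prism_dist (hn : 2 ≤ n) (hv : v * u = 1) (l : ZMod n) (g : DihedralGroup n) :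
    (Cay {r u, r (-u), sr p}).dist g (r l) =
      cycDist n (prismPos p v g) (l * v).val + prismSide g := by
  have : Fact (1 < n) := ⟨by omega⟩
  have hu : u ≠ 0 := by
    rintro rfl
    simp at hv
  have hw : (l * v).val < n := ZMod.val_lt _
  refine Cay_dist_eq_of_potential (by simp [one_ne_sr, one_eq_r_iff, hu])
    (by simp [Set.inv_insert, Set.insert_comm]) (r l)
    (fun g => cycDist n (prismPos p v g) (l * v).val + prismSide g)
    (by simp [cycDist, prismPos, prismSide]) ?_ ?_ g
  · intro s hs g
    have hside := prismSide_le_one g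
    rcases hs with rfl | rfl | rfl
    · rw [prismSide_r_mul]
      rcases prismPos_isNext (p := p) hn hv g with ⟨h, -⟩ | ⟨-, h⟩ <;>
        have := h.cycDist_le (prismPos_lt hn _) hw <;> omega
    · rw [prismSide_r_mul]
      rcases prismPos_isNext (p := p) hn hv g with ⟨-, h⟩ | ⟨h, -⟩ <;>
        have := h.cycDist_le (prismPos_lt hn _) hw <;> omega
    · rw [prismSide_sr_mul, prismPos_sr_mul]
      omega
  · intro g hgw
    by_cases hside : prismSide g = 0
    · have hne : prismPos p v g ≠ (l * v).val :=
        fun h => hgw (prism_ext (p := p) hn hv h hside)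
      rcases prismPos_isNext (p := p) hn hv g with ⟨h1, h2⟩ | ⟨h1, h2⟩ <;>
        rcases h1.cycDist_lt_or_lt h2 (prismPos_lt hn _) hw hne with h | h <;>
        first
        | exact ⟨r u, by simp, by simpa only [prismSide_r_mul, add_lt_add_iff_right] using h⟩
        | exact ⟨r (-u), by simp, by simpa only [prismSide_r_mul, add_lt_add_iff_right] using h⟩
    · refine ⟨sr p, by simp, ?_⟩
      rw [prismSide_sr_mul, prismPos_sr_mul]
      have := prismSide_le_one g
      omega

/-- On a prism over an odd cycle of length `2h + 1`, positions `0` and `h` of the same side form a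
resolving set: the sum of the distances to them is `h + 2ε` on the short arc between them and
`h + 1 + 2ε` on the long one, where `ε` is the side. -/
theorem metricDimension_prism (hn : 2 ≤ n) (hodd : Odd n) (hv : v * u = 1) :
    (Cay {r u, r (-u), sr p}).metricDimension = 2 := by
  have : Fact (1 < n) := ⟨by omega⟩
  have hu : u ≠ 0 := by
    rintro rfl
    simp at hv
  have h1 : (1 : DihedralGroup n) ∉ ({r u, r (-u), sr p} : Set (DihedralGroup n)) := by
    simp [one_ne_sr, one_eq_r_iff, hu]
  obtain ⟨h, rfl⟩ := hodd
  refine SimpleGraph.metricDimension_eq_two (w₁ := r 0) (w₂ := r (h * u)) ?_ ?_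
  · intro x y hxy
    have e1 := hxy (r 0) (by simp)
    have e2 := hxy (r (h * u)) (by simp)
    have hx := prismPos_lt (p := p) (v := v) hn x
    have hy := prismPos_lt (p := p) (v := v) hn y
    have sx := prismSide_le_one x
    have sy := prismSide_le_one y
    have hval : ((h : ZMod (2 * h + 1)) * u * v).val = h := by
      rw [mul_assoc, mul_comm u, hv, mul_one]
      exact ZMod.val_cast_of_lt (by omega)
    rw [Cay_prism_dist hn hv, Cay_prism_dist hn hv] at e1 e2
    rw [zero_mul, ZMod.val_zero] at e1
    rw [hval] at e2
    simp only [cycDist] at e1 e2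
    have : prismPos p v x = prismPos p v y ∧ prismSide x = prismSide y := by omega
    exact prism_ext hn hv this.1 this.2
  · intro w
    refine ⟨r u * w, sr p * w, ?_, Cay_adj_mul_left h1 (by simp) w,
      Cay_adj_mul_left h1 (by simp) w⟩
    intro h
    simpa using mul_right_cancel h

/-! ### Generating sets and parity colourings of dihedral groups -/

/-- The rotation `x` for which the element is `r x` or `sr (p + x)`, that is, the exponent of an
element relative to the reflection `sr p`. -/
def exponentFrom (p : ZMod n) : DihedralGroup n → ZMod n
  | r k => k
  | sr k => k - p

/-- The subgroup generated by the rotations with exponent in `H` and the reflection `sr p`. -/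
def subgroupOfExponents (H : AddSubgroup (ZMod n)) (p : ZMod n) : Subgroup (DihedralGroup n) where
  carrier := {g | exponentFrom p g ∈ H}
  mul_mem' := by
    rintro (k | k) (l | l) hk hl <;>
      simp only [Set.mem_ofPred_eq, exponentFrom, r_mul_r, r_mul_sr, sr_mul_r, sr_mul_sr] at hk hl ⊢
    · exact H.add_mem hk hl
    · rw [show l - k - p = l - p - k by ring]
      exact H.sub_mem hl hk
    · rw [show k + l - p = k - p + l by ring]
      exact H.add_mem hk hl
    · rw [show l - k = l - p - (k - p) by ring]
      exact H.sub_mem hl hk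
  one_mem' := H.zero_mem
  inv_mem' := by
    rintro (k | k) hk
    · exact H.neg_mem hk
    · exact hk

variable {S : Set (DihedralGroup n)}

theorem mem_of_closure_eq_top (hgen : Subgroup.closure S = ⊤) (H : AddSubgroup (ZMod n))
    (p : ZMod n) (hS : ∀ g ∈ S, exponentFrom p g ∈ H) (k : ZMod n) : k ∈ H := by
  have hle : Subgroup.closure S ≤ subgroupOfExponents H p := (Subgroup.closure_le _).mpr hS
  have : r k ∈ subgroupOfExponents H p := hle (hgen ▸ Subgroup.mem_top _)
  exact this

theorem exists_sr_mem (hgen : Subgroup.closure S = ⊤) : ∃ p, sr p ∈ S := by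
  by_contra! hno
  have key : ∀ g ∈ Subgroup.closure S, ∃ k, g = r k := by
    intro g hg
    induction hg using Subgroup.closure_induction with
    | mem g hg =>
      rcases g with k | k
      · exact ⟨k, rfl⟩
      · exact absurd hg (hno k)
    | one => exact ⟨0, rfl⟩
    | mul x y _ _ hx hy =>
      obtain ⟨k, rfl⟩ := hx
      obtain ⟨l, rfl⟩ := hy
      exact ⟨k + l, rfl⟩
    | inv x _ hx =>
      obtain ⟨k, rfl⟩ := hx
      exact ⟨-k, rfl⟩
  obtain ⟨k, hk⟩ := key (sr 0) (hgen ▸ Subgroup.mem_top _)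
  cases hk

theorem isUnit_of_closure_eq_top (hgen : Subgroup.closure S = ⊤) (p u : ZMod n)
    (hS : ∀ g ∈ S, exponentFrom p g ∈ AddSubgroup.zmultiples u) : IsUnit u := by
  obtain ⟨m, hm⟩ := AddSubgroup.mem_zmultiples_iff.mp (mem_of_closure_eq_top hgen _ p hS 1)
  rw [zsmul_eq_mul] at hm
  exact IsUnit.of_mul_eq_one_right _ hm

/-- A homomorphism `π` to `ℤ/2` that is odd on the rotations in `S` and constant on the
reflections in `S` makes `Cay S` bipartite: reflections get the colour of their exponent
shifted by one. -/
theorem encard_le_two_of_parity (hgen : Subgroup.closure S = ⊤) (hone : (1 : DihedralGroup n) ∉ S)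
    (hinv : S = S⁻¹) {w₁ w₂ : DihedralGroup n} (hW : (Cay S).IsResolvingSet {w₁, w₂})
    (π : ZMod n →+ ZMod 2) (hsr : ∀ q, sr q ∈ S → π q = π p) (hr : ∀ k, r k ∈ S → π k = 1) :
    S.encard ≤ 2 := by
  have h2 : (2 : ZMod 2) = 0 := rfl
  refine Cay_encard_le_two_of_parity hgen hone hinv hW
    (fun | r k => π k | sr k => π k - π p + 1) ?_
  rintro (i | q) hs (k | k)
  · simp only [r_mul_r, map_add, hr i hs]
    ring
  · simp only [r_mul_sr, map_sub, hr i hs]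
    linear_combination -h2
  · simp only [sr_mul_r, map_add, hsr q hs]
    ring
  · simp only [sr_mul_sr, map_sub, hsr q hs]
    linear_combination -h2

/-! ### Connection sets admitting a resolving pair -/

/-- A connection set with only one reflection consists of this reflection and a pair of mutually
inverse generators of the rotations. -/
theorem eq_prism_of_unique_reflection (hn : 2 ≤ n) (hgen : Subgroup.closure S = ⊤)
    (hone : (1 : DihedralGroup n) ∉ S) (hinv : S = S⁻¹) (hcard : S.encard ≤ 3) (hp : sr p ∈ S)
    (huniq : ∀ q, sr q ∈ S → q = p) : ∃ i, IsUnit i ∧ S = {r i, r (-i), sr p} := by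
  have : Fact (1 < n) := ⟨by omega⟩
  have hneg : ∀ k, r k ∈ S → r (-k) ∈ S := by
    intro k hk
    rw [hinv]
    simpa using hk
  have hne0 : ∀ k, r k ∈ S → k ≠ 0 := by
    rintro k hk rfl
    exact hone hk
  have htriple : ∀ k, r k ∈ S → k ≠ -k → S = {r k, r (-k), sr p} := fun k hk hkk =>
    Set.eq_of_encard_le_three hcard hk (hneg k hk) hp (by simpa using hkk) (by simp) (by simp)
  obtain ⟨i, hi⟩ : ∃ i, r i ∈ S := by
    by_contra! hno
    have h1 : (1 : ZMod n) ∈ (⊥ : AddSubgroup (ZMod n)) := by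
      refine mem_of_closure_eq_top hgen ⊥ p ?_ 1
      rintro (k | k) hk
      · exact absurd hk (hno k)
      · simp [exponentFrom, huniq k hk]
    exact one_ne_zero (AddSubgroup.mem_bot.mp h1)
  have hS : S = {r i, r (-i), sr p} := by
    by_cases hii : i = -i
    · refine Set.Subset.antisymm ?_ ?_
      · rintro (j | q) hj
        · suffices j = i by simp [this]
          by_cases hjj : j = -j
          · -- `ℤ/n` has at most one involution
            have e1 := ZMod.two_mul_val_of_involution hn
              (by linear_combination hii) (hne0 i hi)
            have e2 := ZMod.two_mul_val_of_involution hn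
              (by linear_combination hjj) (hne0 j hj)
            exact ZMod.val_injective n (by omega)
          · rw [htriple j hj hjj] at hi
            simp only [Set.mem_insert_iff, r.injEq, Set.mem_singleton_iff, reduceCtorEq,
              or_false] at hi
            rcases hi with rfl | rfl
            · rfl
            · rw [neg_neg] at hii
              exact hii.symm
        · simp [huniq q hj]
      · rintro _ (rfl | rfl | rfl)
        exacts [hi, hneg i hi, hp]
    · exact htriple i hi hii
  refine ⟨i, isUnit_of_closure_eq_top hgen p i ?_, hS⟩
  rw [hS]
  rintro _ (rfl | rfl | rfl)
  · exact AddSubgroup.mem_zmultiples i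
  · exact neg_mem (AddSubgroup.mem_zmultiples i)
  · simp [exponentFrom]

/-- Two reflections and the central involution never admit a resolving pair: the Cayley graph is
bipartite if the exponents of the reflections differ by an even amount, and a Möbius ladder
otherwise. -/
theorem not_isResolvingSet_two_reflections_involution (hn : 2 ≤ n) {k : ZMod n} (hk : k + k = 0)
    (hk0 : k ≠ 0) (hu0 : u ≠ 0)
    (hgen : Subgroup.closure ({sr p, sr (p + u), r k} : Set (DihedralGroup n)) = ⊤)
    (w₁ w₂ : DihedralGroup n) :
    ¬ (Cay {sr p, sr (p + u), r k}).IsResolvingSet {w₁, w₂} := by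
  intro hW
  have : NeZero n := ⟨by omega⟩
  have hdvd : 2 ∣ n := ⟨_, (ZMod.two_mul_val_of_involution hn hk hk0).symm⟩
  let π : ZMod n →+* ZMod 2 := ZMod.castHom hdvd (ZMod 2)
  obtain ⟨x, y, hxy⟩ : ∃ x y : ℤ, (x : ZMod n) * u + y * k = 1 := by
    have h1 := mem_of_closure_eq_top hgen (AddSubgroup.closure {u, k}) p (by
      rintro _ (rfl | rfl | rfl)
      · simp [exponentFrom]
      · simpa [exponentFrom] using AddSubgroup.subset_closure (Set.mem_insert _ _)
      · exact AddSubgroup.subset_closure (Set.mem_insert_of_mem _ rfl)) 1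
    obtain ⟨x, y, hxy⟩ := AddSubgroup.mem_closure_pair.mp h1
    exact ⟨x, y, by simpa only [zsmul_eq_mul] using hxy⟩
  by_cases hπ : π u = 0
  · have hπk : π k = 1 := by
      have h := congrArg π hxy
      rw [map_add, map_mul, map_mul, hπ, mul_zero, zero_add, map_one] at h
      exact ZMod.two_eq_one_of_mul h
    refine Set.not_encard_triple_le_two (x := sr p) (y := sr (p + u)) (z := r k) (by simpa using hu0)
      (by simp) (by simp)
      (encard_le_two_of_parity (p := p) hgen (by simp [one_ne_sr, one_eq_r_iff, hk0]) ?_ hW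
        π.toAddMonoidHom ?_ ?_)
    · have hkk : -k = k := by linear_combination -hk
      simp [Set.inv_insert, hkk]
    · intro q hq
      simp only [Set.mem_insert_iff, sr.injEq, Set.mem_singleton_iff, reduceCtorEq,
        or_false] at hq
      rcases hq with rfl | rfl
      · rfl
      · simpa using hπ
    · intro l hl
      simp only [Set.mem_insert_iff, r.injEq, Set.mem_singleton_iff, reduceCtorEq,
        false_or] at hl
      subst hl
      exact hπk
  · have hπ1 : π (u - 1) = 0 := by
      have : ∀ t : ZMod 2, t ≠ 0 → t - 1 = 0 := by decide
      rw [map_sub, map_one]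
      exact this _ hπ
    obtain ⟨w, hw⟩ : ∃ w : ZMod n, u - 1 = 2 * w := by
      rw [ZMod.castHom_apply, ZMod.cast_eq_val, ZMod.natCast_eq_zero_iff] at hπ1
      obtain ⟨w, hw⟩ := hπ1
      refine ⟨w, ?_⟩
      rw [← ZMod.natCast_zmod_val (u - 1), hw]
      push_cast
      rfl
    -- doubling `x * u + y * k = 1` gives `2 = 2 * x * u`, so that `1 = u - 2 * w` is a multiple
    -- of `u`
    have hv : (1 - 2 * x * w) * u = 1 := by
      linear_combination hw + (-2 * w) * hxy + w * y * hk
    exact not_isResolvingSet_moebius hn hv hk hk0 hgen w₁ w₂ hW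

theorem eq_of_isResolvingSet_pair (hn : 2 ≤ n) (hgen : Subgroup.closure S = ⊤)
    (hone : (1 : DihedralGroup n) ∉ S) (hinv : S = S⁻¹) {w₁ w₂ : DihedralGroup n}
    (hW : (Cay S).IsResolvingSet {w₁, w₂}) :
    (n = 2 ∧ S.ncard = 2) ∨ (∃ p u, IsUnit u ∧ S = {sr p, sr (p + u)}) ∨
      (Odd n ∧ ∃ u p, IsUnit u ∧ S = {r u, r (-u), sr p}) := by
  have hcard := Cay_encard_le_three hone hW
  obtain ⟨p, hp⟩ := exists_sr_mem hgen
  by_cases huniq : ∀ q, sr q ∈ S → q = p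
  · obtain ⟨i, hi, hS⟩ := eq_prism_of_unique_reflection hn hgen hone hinv hcard hp huniq
    by_cases hii : i = -i
    · left
      have h2 : ((2 : ℕ) : ZMod n) = 0 := by
        apply hi.mul_left_cancel
        push_cast
        linear_combination hii
      have hn2 := Nat.le_of_dvd (by norm_num) ((ZMod.natCast_eq_zero_iff 2 n).mp h2)
      refine ⟨by omega, ?_⟩
      rw [hS, ← hii, Set.insert_eq_of_mem (Set.mem_insert _ _)]
      exact Set.ncard_pair (by simp)
    · refine Or.inr (Or.inr ⟨?_, i, p, hi, hS⟩)
      by_contra hodd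
      have hdvd : 2 ∣ n := (Nat.not_odd_iff_even.mp hodd).two_dvd
      let π : ZMod n →+* ZMod 2 := ZMod.castHom hdvd (ZMod 2)
      have hπ : π i = 1 := by
        obtain ⟨j, hj⟩ := hi.exists_left_inv
        exact ZMod.two_eq_one_of_mul (x := π j) (by rw [← map_mul, hj, map_one])
      have hle := encard_le_two_of_parity (p := p) hgen hone hinv hW π.toAddMonoidHom
        (fun q hq => by rw [huniq q hq]) (fun k hk => by
          rw [hS] at hk
          simp only [Set.mem_insert_iff, r.injEq, Set.mem_singleton_iff, reduceCtorEq,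
            or_false] at hk
          rcases hk with rfl | rfl
          · exact hπ
          · change π (-i) = 1
            rw [map_neg, hπ]
            rfl)
      rw [hS] at hle
      exact Set.not_encard_triple_le_two (by simpa using hii) (by simp) (by simp) hle
  · push Not at huniq
    obtain ⟨q, hq, hqp⟩ := huniq
    obtain ⟨u, rfl⟩ : ∃ u, q = p + u := ⟨q - p, by ring⟩
    have hu0 : u ≠ 0 := by simpa using hqp
    by_cases hS : S = {sr p, sr (p + u)}
    · refine Or.inr (Or.inl ⟨p, u, isUnit_of_closure_eq_top hgen p u ?_, hS⟩)
      rw [hS]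
      rintro _ (rfl | rfl)
      · simp [exponentFrom]
      · simp [exponentFrom]
    · exfalso
      obtain ⟨g, hg, hgne⟩ : ∃ g ∈ S, g ∉ ({sr p, sr (p + u)} : Set (DihedralGroup n)) := by
        by_contra! hsub
        refine hS (Set.Subset.antisymm hsub ?_)
        rintro _ (rfl | rfl) <;> assumption
      have hne : g ≠ sr p ∧ g ≠ sr (p + u) := by simpa using hgne
      have hS3 := Set.eq_of_encard_le_three hcard hp hq hg (by simpa using hu0) hne.1.symm hne.2.symm
      rcases g with k | k
      · have hkk : k + k = 0 := by
          have hmem : r (-k) ∈ S := by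
            rw [hinv]
            simpa using hg
          rw [hS3] at hmem
          simp only [Set.mem_insert_iff, r.injEq, Set.mem_singleton_iff, reduceCtorEq,
            false_or] at hmem
          linear_combination -hmem
        have hk0 : k ≠ 0 := by
          rintro rfl
          exact hone hg
        subst hS3
        exact not_isResolvingSet_two_reflections_involution hn hkk hk0 hu0 hgen w₁ w₂ hW
      · -- all elements of `S` are reflections, and the determinant is a two-colouring
        have hle := encard_le_two_of_parity (p := p) hgen hone hinv hW 0 (fun _ _ => rfl)
          (fun l hl => by
            rw [hS3] at hl
            simp at hl)
        rw [hS3] at hle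
        exact Set.not_encard_triple_le_two (by simpa using hu0) hne.1.symm hne.2.symm hle

/-! ### The Klein four-group -/

theorem metricDimension_klein_four {S : Set (DihedralGroup 2)} (hgen : Subgroup.closure S = ⊤)
    (hone : (1 : DihedralGroup 2) ∉ S) (hinv : S = S⁻¹) (hcard : S.ncard = 2) :
    (Cay S).metricDimension = 2 := by
  obtain ⟨x, y, hxy, rfl⟩ := Set.ncard_eq_two.mp hcard
  have hconn := Cay_connected hgen hone
  have hx1 : x ≠ 1 := by
    rintro rfl
    simp at hone
  have hy1 : y ≠ 1 := by
    rintro rfl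
    simp at hone
  -- in a `4`-cycle, adjacent vertices are resolving because of the distances `0` and `1` alone
  have key : ∀ x y : DihedralGroup 2, x ≠ y → x ≠ 1 → y ≠ 1 → ∀ g h : DihedralGroup 2,
      (g = 1 ↔ h = 1) → (g = x ↔ h = x) → (g = x ∨ g = y ↔ h = x ∨ h = y) →
      (g * x⁻¹ = x ∨ g * x⁻¹ = y ↔ h * x⁻¹ = x ∨ h * x⁻¹ = y) → g = h := by
    decide
  refine SimpleGraph.metricDimension_eq_two (w₁ := 1) (w₂ := x) ?_ ?_
  · intro g h hgh
    have hd1 := hgh 1 (by simp)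
    have hdx := hgh x (by simp)
    have eq_iff : ∀ w, (Cay {x, y}).dist g w = (Cay {x, y}).dist h w → (g = w ↔ h = w) := by
      intro w hw
      rw [← hconn.dist_eq_zero_iff, hw, hconn.dist_eq_zero_iff]
    have adj_iff : ∀ w, (Cay {x, y}).dist g w = (Cay {x, y}).dist h w →
        (g * w⁻¹ ∈ ({x, y} : Set (DihedralGroup 2)) ↔ h * w⁻¹ ∈ ({x, y} : Set _)) := by
      intro w hw
      rw [← Cay_adj hone hinv, ← Cay_adj hone hinv, ← SimpleGraph.dist_eq_one_iff_adj, hw,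
        SimpleGraph.dist_eq_one_iff_adj]
    exact key x y hxy hx1 hy1 g h (eq_iff 1 hd1) (eq_iff x hdx) (by simpa using adj_iff 1 hd1)
      (by simpa only [Set.mem_insert_iff, Set.mem_singleton_iff] using adj_iff x hdx)
  · intro w
    exact ⟨x * w, y * w, fun h => hxy (mul_right_cancel h),
      Cay_adj_mul_left hone (by simp) w, Cay_adj_mul_left hone (by simp) w⟩

end DihedralGroup

/-- In `DihedralGroup n`, of order `2 * n`, the standard generators are `a = r 1` and `b = sr 0`. -/
theorem mainTheorem1 (n : ℕ) (hn : 2 ≤ n) (a b : DihedralGroup n)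
    (ha : a = DihedralGroup.r 1) (hb : b = DihedralGroup.sr 0)
    (S : Set (DihedralGroup n)) (hgen : Subgroup.closure S = ⊤)
    (hone : (1 : DihedralGroup n) ∉ S) (hinv : S = S⁻¹) :
    (Cay S).metricDimension = 2 ↔
      (n = 2 ∧ S.ncard = 2) ∨
      (∃ i j : ℤ, S = {a ^ i * b, a ^ j * b} ∧ Int.gcd (i - j) n = 1) ∨
      (Odd n ∧ ∃ i j : ℤ, S = {a ^ i, a ^ (-i), a ^ j * b} ∧ Int.gcd i n = 1) := by
  subst ha hb
  simp only [ZMod.intGcd_eq_one_iff_isUnit, DihedralGroup.r_one_zpow,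
    DihedralGroup.r_mul_sr, zero_sub, Int.cast_neg, Int.cast_sub]
  constructor
  · intro h
    obtain ⟨w₁, w₂, hW⟩ := SimpleGraph.exists_isResolvingSet_pair h
    rcases DihedralGroup.eq_of_isResolvingSet_pair hn hgen hone hinv hW with
      h | ⟨p, u, hu, hS⟩ | ⟨hodd, u, p, hu, hS⟩
    · exact Or.inl h
    · obtain ⟨i, hi⟩ := ZMod.intCast_surjective (-p)
      obtain ⟨j, hj⟩ := ZMod.intCast_surjective (-(p + u))
      refine Or.inr (Or.inl ⟨i, j, ?_, ?_⟩)
      · rw [hi, hj, neg_neg, neg_neg, hS]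
      · rw [hi, hj]
        convert hu using 1
        ring
    · obtain ⟨i, hi⟩ := ZMod.intCast_surjective u
      obtain ⟨j, hj⟩ := ZMod.intCast_surjective (-p)
      refine Or.inr (Or.inr ⟨hodd, i, j, ?_, ?_⟩)
      · rw [hi, hj, neg_neg, hS]
      · rwa [hi]
  · rintro (⟨rfl, hcard⟩ | ⟨i, j, rfl, hu⟩ | ⟨hodd, i, j, rfl, hu⟩)
    · exact DihedralGroup.metricDimension_klein_four hgen hone hinv hcard
    · obtain ⟨v, hv⟩ := hu.exists_left_inv
      have := DihedralGroup.metricDimension_cycle (p := -(i : ZMod n)) hn hv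
      rwa [show -(i : ZMod n) + (i - j) = -j by ring] at this
    · obtain ⟨v, hv⟩ := hu.exists_left_inv
      exact DihedralGroup.metricDimension_prism hn hodd hv
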